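/- Let $n\ge 3$, let $M$ be a compact smooth $n$-dimensional manifold, possibly with boundary, with inclusion $j:\partial M\to M$, and let $\beta\in\Omega^{n-1}(M)$ be closed. For a Riemannian metric $g$ with volume density $\mu_g$ and induced pointwise norm $|\cdot|_g$ on forms, put $\|\gamma\|_{L^2,g}^2=\int|\gamma|_g^2\,\mu_g$ and $\|\gamma\|_{L^1,g}=\int|\gamma|_g\,\mu_g$, the integrals being taken over the set on which $g$ is defined. Consider three classes of admissible variations $\mathring\beta\in\Omega^{n-1}(M)$ of $\beta$: 1. $d\mathring\beta=0$ and $j^*\mathring\beta=0$; 2. $\mathring\beta=d\alpha$ with $\alpha\in\Omega^{n-2}(M)$, $j^*\alpha=0$ (homological constraint); 3. $\mathring\beta=-\mathscr L_\xi\beta$ with $\xi$ a smooth vector field compactly supported in the interior of $M$ (isotopy constraint). For each class, $\beta$ is called a stationary point of a functional $F$ if $\frac{d}{dt}\big|_{t=0}F(\beta+t\mathring\beta)$ exists and equals $0$ for every admissible $\mathring\beta$ of that class. (a) Let $\hat g$ be a smooth Riemannian metric on $M$. Then $\bar g=|\beta|_{\hat g}^2\,\hat g$ is a smooth Riemannian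 metric on the open set $U=\{p\in M:\beta_p\neq 0\}$, one has $\|\beta\|_{L^2,\hat g}^2=\|\beta\|_{L^1,\bar g}$ (the right-hand integral being over $U$), and, for each of the three classes, $\beta$ is a stationary point of $\gamma\mapsto\|\gamma\|_{L^2,\hat g}^2$ if and only if it is a stationary point of $\gamma\mapsto\|\gamma\|_{L^1,\bar g}$, where the metrics $\hat g$ and $\bar g$ are kept fixed. (b) If $\beta$ vanishes nowhere, then every smooth Riemannian metric $\bar g$ on $M$ arises in this way from exactly one smooth Riemannian metric $\hat g$ on $M$: there is a unique $\hat g$ with $\bar g=|\beta|_{\hat g}^2\,\hat g$. Hence, in each class, $L^1$-stationary points for any given metric $\bar g$ are also squared-$L^2$-stationary points for a conformally related metric $\hat g$. -/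

import Mathlib

open Set Bundle
open scoped Manifold ContDiff

noncomputable section

namespace FluxForm

/-- Model vector space of an `n`-dimensional manifold. -/
abbrev Eu (n : ℕ) : Type := EuclideanSpace ℝ (Fin n)

section Basic

variable (n : ℕ) [NeZero n] (M : Type*) [TopologicalSpace M]
  [ChartedSpace (EuclideanHalfSpace n) M]

/-- A (not necessarily smooth) differential `k`-form on the manifold with boundary `M`. -/
abbrev Form (k : ℕ) : Type _ :=
  ∀ p : M, TangentSpace (𝓡∂ n) p [⋀^Fin k]→L[ℝ] ℝ

/-- A field of bilinear forms on the tangent spaces of `M`. -/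
abbrev BilinField : Type _ :=
  ∀ p : M, TangentSpace (𝓡∂ n) p →L[ℝ] TangentSpace (𝓡∂ n) p →L[ℝ] ℝ

/-- Smooth Riemannian metrics on `M`. -/
abbrev Metric [IsManifold (𝓡∂ n) ∞ M] : Type _ :=
  ContMDiffRiemannianMetric (𝓡∂ n) ∞ (Eu n) (fun p : M => TangentSpace (𝓡∂ n) p)

variable {n M}

/-! ### Smooth forms, exterior derivative, Lie derivative, restriction to the boundary -/

/-- Differential at `y` of the inverse of the chart around `x`. -/
def chartInvDeriv (x : M) (y : Eu n) :
    Eu n →L[ℝ] TangentSpace (𝓡∂ n) ((extChartAt (𝓡∂ n) x).symm y) :=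
  mfderivWithin 𝓘(ℝ, Eu n) (𝓡∂ n) (extChartAt (𝓡∂ n) x).symm (range (𝓡∂ n)) y

/-- Differential at `p` of the chart around `x`. -/
def chartDeriv (x p : M) : TangentSpace (𝓡∂ n) p →L[ℝ] Eu n :=
  mfderiv (𝓡∂ n) 𝓘(ℝ, Eu n) (extChartAt (𝓡∂ n) x) p

/-- The form `η` read in the chart around `x`: its pullback by the inverse chart
(meaningful on the target of the chart). -/
def chartForm {k : ℕ} (x : M) (η : Form n M k) (y : Eu n) : Eu n [⋀^Fin k]→L[ℝ] ℝ :=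
  (η ((extChartAt (𝓡∂ n) x).symm y)).compContinuousLinearMap (chartInvDeriv x y)

/-- The vector field `ξ` read in the chart around `x`. -/
def chartVector (x : M) (ξ : ∀ p : M, TangentSpace (𝓡∂ n) p) (y : Eu n) : Eu n :=
  chartDeriv x ((extChartAt (𝓡∂ n) x).symm y) (ξ ((extChartAt (𝓡∂ n) x).symm y))

/-- `η` is smooth, i.e. an element of `Ω^k(M)`: smooth in the chart around each point,
up to the boundary. -/
def IsSmoothForm {k : ℕ} (η : Form n M k) : Prop :=
  ∀ x : M, ContDiffOn ℝ ∞ (chartForm x η) (extChartAt (𝓡∂ n) x).target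

/-- The exterior derivative, computed at `p` in the chart around `p`. -/
def extD {k : ℕ} (η : Form n M k) : Form n M (k + 1) := fun p =>
  (extDerivWithin (chartForm p η) (range (𝓡∂ n))
    (extChartAt (𝓡∂ n) p p)).compContinuousLinearMap (chartDeriv p p)

/-- The Lie derivative `(L_ξ η)_p(v₁, …, v_k)`, computed at `p` in the chart around `p`:
`(D_ξ η)(v₁, …, v_k) + ∑ᵢ η(v₁, …, (Dξ)(vᵢ), …, v_k)`. -/
def lieD {k : ℕ} (ξ : ∀ p : M, TangentSpace (𝓡∂ n) p) (η : Form n M k) (p : M)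
    (v : Fin k → TangentSpace (𝓡∂ n) p) : ℝ :=
  let y := extChartAt (𝓡∂ n) p p
  let w : Fin k → Eu n := fun i => chartDeriv p p (v i)
  fderivWithin ℝ (chartForm p η) (range (𝓡∂ n)) y (chartVector p ξ y) w +
    ∑ i, chartForm p η y
      (Function.update w i (fderivWithin ℝ (chartVector p ξ) (range (𝓡∂ n)) y (w i)))

/-- The subspace of `T_pM` of vectors tangent to the boundary, at a boundary point `p`:
the half-space model is `{x | 0 ≤ x 0}`. -/
def boundaryTangent (p : M) : Submodule ℝ (TangentSpace (𝓡∂ n) p) :=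
  LinearMap.ker ((EuclideanSpace.proj (0 : Fin n) : Eu n →L[ℝ] ℝ).comp (chartDeriv p p)).toLinearMap

/-- The pullback `j^*η` of `η` by the inclusion `j : ∂M → M`. -/
def boundaryPullback {k : ℕ} (η : Form n M k) (p : (𝓡∂ n).boundary M) :
    (boundaryTangent (n := n) (p : M)) [⋀^Fin k]→L[ℝ] ℝ :=
  (η (p : M)).compContinuousLinearMap (boundaryTangent (n := n) (p : M)).subtypeL

/-! ### Norms and integrals -/

/-- The Gram matrix of the bilinear form `g_p` in a family of tangent vectors at `p`. -/
def gram (g : BilinField n M) (p : M) (b : Fin n → TangentSpace (𝓡∂ n) p) :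
    Matrix (Fin n) (Fin n) ℝ :=
  Matrix.of fun i j => g p (b i) (b j)

/-- The standard basis vectors of `T_pM` (the coordinate vectors of the preferred chart). -/
def stdVec (p : M) (i : Fin n) : TangentSpace (𝓡∂ n) p :=
  (EuclideanSpace.single i (1 : ℝ) : Eu n)

/-- The squared pointwise norm of a `k`-form,
`|η|_g² = (1 / k!) g^{i₁j₁} ⋯ g^{i_kj_k} η_{i₁…i_k} η_{j₁…j_k}`; this does not depend on the basis,
and equals `∑_{i₁<⋯<i_k} η(e_{i₁}, …, e_{i_k})²` in a `g`-orthonormal basis. -/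
def normSq {k : ℕ} (g : BilinField n M) (η : Form n M k) (p : M) : ℝ :=
  (1 / (k.factorial : ℝ)) * ∑ I : Fin k → Fin n, ∑ J : Fin k → Fin n,
    (∏ l, (gram g p (stdVec p))⁻¹ (I l) (J l)) *
      η p (fun l => stdVec p (I l)) * η p (fun l => stdVec p (J l))

/-- The density `√det g_{ij}` of the Riemannian volume in the chart around `x`. -/
def volDensity (g : BilinField n M) (x : M) (y : Eu n) : ℝ :=
  √ (gram g ((extChartAt (𝓡∂ n) x).symm y)
      (fun i => chartInvDeriv x y (EuclideanSpace.single i (1 : ℝ)))).det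

section Integral

variable (n M) [T2Space M] [SigmaCompactSpace M] [IsManifold (𝓡∂ n) ∞ M]

/-- A smooth partition of unity on `M` subordinate to the domains of the charts. -/
def chartPartition : SmoothPartitionOfUnity M (𝓡∂ n) M univ :=
  (SmoothPartitionOfUnity.exists_isSubordinate_chartAt_source (𝓡∂ n) M).choose

theorem chartPartition_isSubordinate :
    (chartPartition n M).IsSubordinate
      (fun x => (chartAt (EuclideanHalfSpace n) x).source) :=
  (SmoothPartitionOfUnity.exists_isSubordinate_chartAt_source (𝓡∂ n) M).choose_spec

variable {n M}

/-- The integral `∫_M f μ_g` of a function against the Riemannian volume of `g`, by a partition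
of unity. -/
def volIntegral (g : BilinField n M) (f : M → ℝ) : ℝ :=
  ∑ᶠ x : M, ∫ y in (extChartAt (𝓡∂ n) x).target,
    chartPartition n M x ((extChartAt (𝓡∂ n) x).symm y) *
      f ((extChartAt (𝓡∂ n) x).symm y) * volDensity g x y

/-- The squared `L²`-norm `∫_M |η|_g² μ_g`. -/
def l2NormSq {k : ℕ} (g : BilinField n M) (η : Form n M k) : ℝ :=
  volIntegral g (fun p => normSq g η p)

/-- The `L¹`-norm `∫_U |η|_g μ_g` over the set `U` on which `g` is a Riemannian metric. -/
def l1NormOn {k : ℕ} (g : BilinField n M) (U : Set M) (η : Form n M k) : ℝ :=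
  volIntegral g (U.indicator fun p => √ (normSq g η p))

end Integral

/-- `g` is a smooth Riemannian metric on the (open) set `U`. -/
structure IsRiemannianMetricOn [IsManifold (𝓡∂ n) ∞ M] (g : BilinField n M) (U : Set M) :
    Prop where
  symm : ∀ p ∈ U, ∀ v w, g p v w = g p w v
  pos : ∀ p ∈ U, ∀ v, v ≠ 0 → 0 < g p v v
  smooth : ContMDiffOn (𝓡∂ n) ((𝓡∂ n).prod 𝓘(ℝ, Eu n →L[ℝ] Eu n →L[ℝ] ℝ)) ∞
    (fun p : M => TotalSpace.mk' (Eu n →L[ℝ] Eu n →L[ℝ] ℝ)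
      (E := fun p : M => TangentSpace (𝓡∂ n) p →L[ℝ] TangentSpace (𝓡∂ n) p →L[ℝ] ℝ) p (g p)) U

/-- The conformally changed metric `|β|_g² g`. -/
def conformalChange {k : ℕ} (g : BilinField n M) (β : Form n M k) : BilinField n M :=
  fun p => normSq g β p • g p

/-- The set of points where a form does not vanish. -/
def nonvanishing {k : ℕ} (β : Form n M k) : Set M := {p | β p ≠ 0}

end Basic

/-! ### Constrained variations and stationary points -/

section Variations

variable {m : ℕ} {M : Type*} [TopologicalSpace M] [ChartedSpace (EuclideanHalfSpace (m + 2)) M]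
  [IsManifold (𝓡∂ (m + 2)) ∞ M]

/-- The three kinds of constraints on the variations. -/
inductive Constraint
  /-- only closedness and the boundary condition are prescribed -/
  | boundary
  /-- homologically constrained variations -/
  | homological
  /-- isotopy constrained variations -/
  | isotopy

/-- `γ ∈ Ω^{n-1}(M)` (with `n = m + 2`) is an admissible variation of the flux form `β`:
* boundary: `dγ = 0` and `j^*γ = 0`;
* homological: `γ = dα` for some `α ∈ Ω^{n-2}(M)` with `j^*α = 0`;
* isotopy: `γ = -L_ξ β` for some smooth vector field `ξ` with compact support in the interior. -/
def IsAdmissible (c : Constraint) (β γ : Form (m + 2) M (m + 1)) : Prop :=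
  IsSmoothForm γ ∧
  match c with
  | .boundary => extD γ = 0 ∧ boundaryPullback γ = 0
  | .homological => ∃ α : Form (m + 2) M m,
      IsSmoothForm α ∧ boundaryPullback α = 0 ∧ γ = extD α
  | .isotopy => ∃ ξ : ∀ p : M, TangentSpace (𝓡∂ (m + 2)) p,
      ContMDiff (𝓡∂ (m + 2)) (𝓡∂ (m + 2)).tangent ∞
        (fun p => (⟨p, ξ p⟩ : TangentBundle (𝓡∂ (m + 2)) M)) ∧
      (∃ K : Set M, IsCompact K ∧ K ⊆ (𝓡∂ (m + 2)).interior M ∧ ∀ p ∉ K, ξ p = 0) ∧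
      ∀ p v, γ p v = -lieD ξ β p v

/-- `β` is a stationary point of the functional `F` under the constraint `c`: the first variation
of `F` at `β` exists and vanishes along every admissible variation. -/
def IsStationary (c : Constraint) (F : Form (m + 2) M (m + 1) → ℝ)
    (β : Form (m + 2) M (m + 1)) : Prop :=
  ∀ γ : Form (m + 2) M (m + 1), IsAdmissible c β γ →
    HasDerivAt (fun t : ℝ => F (β + t • γ)) 0 0

end Variations

end FluxForm

end

/-! Put λ = |β|²_ĝ. Scaling ĝ by λ divides the squared norm of an (n-1)-form by λ^(n-1) and
multiplies the volume density by λ^(n/2), so |η| μ for the scaled metric equals √λ |η|_ĝ μ_ĝ = |β|_ĝ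
|η|_ĝ μ_ĝ on U. Off U the integrand |β| |η| vanishes. Hence the L¹ functional is η ↦ ∫ |β| |η| for
the fixed smooth metric ĝ (`l1NormOn_conformalChange`), and η = β gives the equality of norms.

Along β + tγ, the derivative at t = 0 of |β| |β + tγ| is ⟨β, γ⟩, also where β = 0, because the
factor |β| then kills the function (`hasDerivAt_norm_mul_norm_add_smul`). That of |β + tγ|² is 2⟨β,
γ⟩. After differentiation under the integral, the two first variations agree up to the factor 2 for
every smooth γ, so the stationary points agree whatever the class of variations.

For (b), the ansatz ĝ = r ḡ turns the equation into r^(n-2) = |β|²_ḡ, which has a unique positive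
smooth root since n ≥ 3 and β vanishes nowhere. -/

noncomputable section

namespace FluxForm

/-! ### Linear algebra: norms of alternating forms in a frame -/

section LinearAlgebra

set_option linter.unusedSectionVars false

open Matrix

variable {ι : Type*} [Fintype ι] [DecidableEq ι] {k : ℕ}

/-- The `k`-th tensor power of a square matrix. -/
def tensorPower (k : ℕ) (B : Matrix ι ι ℝ) : Matrix (Fin k → ι) (Fin k → ι) ℝ :=
  Matrix.of fun I J => ∏ l, B (I l) (J l)

theorem tensorPower_mul (B C : Matrix ι ι ℝ) :
    tensorPower k (B * C) = tensorPower k B * tensorPower k C := by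
  ext I J
  simp only [tensorPower, Matrix.of_apply, Matrix.mul_apply, ← Finset.prod_mul_distrib]
  rw [Finset.prod_univ_sum, Fintype.piFinset_univ]

theorem tensorPower_transpose (B : Matrix ι ι ℝ) :
    tensorPower k Bᵀ = (tensorPower k B)ᵀ := rfl

theorem tensorPower_one : tensorPower k (1 : Matrix ι ι ℝ) = 1 := by
  ext I J
  simp only [tensorPower, Matrix.of_apply, Matrix.one_apply]
  rw [Finset.prod_ite_zero]
  simp [funext_iff]

/-- The squared norm of the covariant `k`-tensor with components `c`, for the scalar product with
Gram matrix `G`. -/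
def tensorNormSq (G : Matrix ι ι ℝ) (c : (Fin k → ι) → ℝ) : ℝ :=
  (1 / (k.factorial : ℝ)) * ∑ I : Fin k → ι, ∑ J : Fin k → ι,
    (∏ l, G⁻¹ (I l) (J l)) * c I * c J

theorem tensorNormSq_eq (G : Matrix ι ι ℝ) (c : (Fin k → ι) → ℝ) :
    tensorNormSq G c = (1 / (k.factorial : ℝ)) * (c ⬝ᵥ tensorPower k G⁻¹ *ᵥ c) := by
  simp only [tensorNormSq, dotProduct, Matrix.mulVec, tensorPower, Matrix.of_apply,
    Finset.mul_sum]
  exact Finset.sum_congr rfl fun I _ => Finset.sum_congr rfl fun J _ => by ring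

/-- The inverse Gram matrix transforms contragrediently to the components, so the tensor powers of
`A` cancel. This is independence of the frame in matrix form. -/
theorem tensorNormSq_congr (A G : Matrix ι ι ℝ) (hA : IsUnit A.det) (c : (Fin k → ι) → ℝ) :
    tensorNormSq (A * G * Aᵀ) (tensorPower k A *ᵥ c) = tensorNormSq G c := by
  have hAt : IsUnit Aᵀ.det := by rwa [Matrix.det_transpose]
  have key : Aᵀ * (A * G * Aᵀ)⁻¹ * A = G⁻¹ := by
    rw [Matrix.mul_inv_rev, Matrix.mul_inv_rev, ← Matrix.mul_assoc, Matrix.mul_nonsing_inv _ hAt,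
      Matrix.one_mul, Matrix.mul_assoc, Matrix.nonsing_inv_mul _ hA, Matrix.mul_one]
  rw [tensorNormSq_eq, tensorNormSq_eq, ← key, tensorPower_mul, tensorPower_mul,
    tensorPower_transpose, ← Matrix.mulVec_mulVec, ← Matrix.mulVec_mulVec,
    Matrix.dotProduct_mulVec c, Matrix.vecMul_transpose]

theorem tensorNormSq_smul {r : ℝ} (hr : r ≠ 0) (G : Matrix ι ι ℝ) (hG : IsUnit G.det)
    (c : (Fin k → ι) → ℝ) : tensorNormSq (r • G) c = (r ^ k)⁻¹ * tensorNormSq G c := by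
  have : (r • G)⁻¹ = r⁻¹ • G⁻¹ := by
    exact Matrix.inv_smul' G (Units.mk0 r hr) hG
  simp only [tensorNormSq, this, Matrix.smul_apply, smul_eq_mul, Finset.prod_mul_distrib,
    Finset.prod_const, Finset.card_univ, Fintype.card_fin, Finset.mul_sum, inv_pow]
  exact Finset.sum_congr rfl fun I _ => Finset.sum_congr rfl fun J _ => by ring

open scoped MatrixOrder in
theorem exists_isUnit_transpose_mul_self {G : Matrix ι ι ℝ} (hG : G.PosDef) :
    ∃ C : Matrix ι ι ℝ, IsUnit C ∧ G = Cᵀ * C := by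
  obtain ⟨C, hC, h⟩ := CStarAlgebra.isStrictlyPositive_iff_eq_star_mul_self.mp
    hG.isStrictlyPositive
  exact ⟨C, hC, by rw [h, Matrix.star_eq_conjTranspose, Matrix.conjTranspose_eq_transpose_of_trivial]⟩

/-- The norm for a positive definite Gram matrix is the pullback of a Euclidean norm by an
injective linear map. -/
theorem exists_tensorNormSq_eq_norm_sq {G : Matrix ι ι ℝ} (hG : G.PosDef) :
    ∃ L : ((Fin k → ι) → ℝ) →ₗ[ℝ] EuclideanSpace ℝ (Fin k → ι), Function.Injective L ∧
      ∀ c, tensorNormSq G c = ‖L c‖ ^ 2 := by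
  obtain ⟨C, hC, h⟩ := exists_isUnit_transpose_mul_self hG.inv
  have hk : (0 : ℝ) < 1 / (k.factorial : ℝ) := by positivity
  -- With `G⁻¹ = Cᵀ * C`, the quadratic form is `1 / k!` times the squared length of `tensorPower k
  -- C *ᵥ c`; injectivity comes from `tensorPower k C⁻¹`.
  refine ⟨√(1 / (k.factorial : ℝ)) • ((WithLp.linearEquiv 2 ℝ ((Fin k → ι) → ℝ)).symm.toLinearMap ∘ₗ
    Matrix.mulVecLin (tensorPower k C)), ?_, fun c => ?_⟩
  · intro c d hcd
    have h1 : tensorPower k C *ᵥ c = tensorPower k C *ᵥ d := by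
      have := smul_right_injective _ (Real.sqrt_pos.2 hk).ne' hcd
      simpa using this
    have h2 : tensorPower k C⁻¹ * tensorPower k C = 1 := by
      rw [← tensorPower_mul, Matrix.nonsing_inv_mul _ ((Matrix.isUnit_iff_isUnit_det _).1 hC),
        tensorPower_one]
    have := congrArg (tensorPower k C⁻¹ *ᵥ ·) h1
    simpa [Matrix.mulVec_mulVec, h2] using this
  · rw [tensorNormSq_eq, h, tensorPower_mul, tensorPower_transpose, ← Matrix.mulVec_mulVec,
      Matrix.dotProduct_mulVec, Matrix.vecMul_transpose]
    simp only [LinearMap.smul_apply, norm_smul, mul_pow, Real.norm_eq_abs, sq_abs,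
      Real.sq_sqrt hk.le, EuclideanSpace.norm_sq_eq, dotProduct]
    congr 1
    exact Finset.sum_congr rfl fun I _ => by simp [sq]

variable {V : Type*} [TopologicalSpace V] [AddCommGroup V] [Module ℝ V]

/-- The Gram matrix of a bilinear form in a frame. -/
def frameGram (g : V →L[ℝ] V →L[ℝ] ℝ) (b : ι → V) : Matrix ι ι ℝ :=
  Matrix.of fun i j => g (b i) (b j)

/-- The components of an alternating form in a frame. -/
def frameComponents (b : ι → V) (η : V [⋀^Fin k]→L[ℝ] ℝ) (I : Fin k → ι) : ℝ :=
  η fun l => b (I l)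

theorem frameGram_change [IsTopologicalAddGroup V] [ContinuousConstSMul ℝ V]
    (g : V →L[ℝ] V →L[ℝ] ℝ) (b : ι → V) (A : Matrix ι ι ℝ) :
    frameGram g (fun i => ∑ j, A i j • b j) = A * frameGram g b * Aᵀ := by
  ext i j
  simp only [frameGram, Matrix.of_apply, Matrix.mul_apply, Matrix.transpose_apply, map_sum,
    map_smul, _root_.sum_apply, _root_.smul_apply, smul_eq_mul,
    Finset.mul_sum, Finset.sum_mul]
  refine Finset.sum_congr rfl fun x _ => Finset.sum_congr rfl fun y _ => by ring

theorem frameComponents_change (b : ι → V) (A : Matrix ι ι ℝ) (η : V [⋀^Fin k]→L[ℝ] ℝ) :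
    frameComponents (fun i => ∑ j, A i j • b j) η = tensorPower k A *ᵥ frameComponents b η := by
  ext I
  simp only [frameComponents, Matrix.mulVec, dotProduct, tensorPower, Matrix.of_apply]
  have := η.toMultilinearMap.map_sum (fun l j => A (I l) j • b j)
  have h2 : ∀ r : Fin k → ι, η.toMultilinearMap (fun l => A (I l) (r l) • b (r l)) =
      (∏ l, A (I l) (r l)) • η.toMultilinearMap (fun l => b (r l)) := fun r =>
    MultilinearMap.map_smul_univ _ _ _
  simp only [h2, smul_eq_mul] at this
  exact this

/-- `normSq` uses at each point the frame of that point's own preferred chart, which need not vary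
continuously. This lemma allows the frame of one fixed chart instead. -/
theorem tensorNormSq_basis_change [IsTopologicalAddGroup V] [ContinuousConstSMul ℝ V]
    (g : V →L[ℝ] V →L[ℝ] ℝ) (η : V [⋀^Fin k]→L[ℝ] ℝ) (b b' : Module.Basis ι ℝ V) :
    tensorNormSq (frameGram g b') (frameComponents b' η) =
      tensorNormSq (frameGram g b) (frameComponents b η) := by
  have hb : (b' : ι → V) = fun i => ∑ j, (b.toMatrix b')ᵀ i j • b j := by
    ext i
    simp [Module.Basis.toMatrix_apply, b.sum_repr]
  have hu : IsUnit ((b.toMatrix b')ᵀ).det := by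
    rw [Matrix.det_transpose]
    let _ := b.invertibleToMatrix b'
    exact (Matrix.isUnit_iff_isUnit_det _).1 (isUnit_of_invertible (b.toMatrix b'))
  rw [hb, frameGram_change, frameComponents_change, tensorNormSq_congr _ _ hu]

theorem frameGram_posDef {g : V →L[ℝ] V →L[ℝ] ℝ}
    [IsTopologicalAddGroup V] [ContinuousConstSMul ℝ V] (hs : ∀ v w, g v w = g w v)
    (hp : ∀ v, v ≠ 0 → 0 < g v v) (b : Module.Basis ι ℝ V) : (frameGram g b).PosDef := by
  refine Matrix.PosDef.of_dotProduct_mulVec_pos ?_ fun x hx => ?_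
  · ext i j
    simp [frameGram, hs (b j)]
  · have h : star x ⬝ᵥ frameGram g b *ᵥ x = g (∑ i, x i • b i) (∑ i, x i • b i) := by
      simp only [frameGram, dotProduct, Matrix.mulVec, Matrix.of_apply, map_sum, map_smul,
        _root_.sum_apply, _root_.smul_apply, smul_eq_mul,
        Finset.mul_sum, star_trivial]
      rw [Finset.sum_comm]
      exact Finset.sum_congr rfl fun i _ => Finset.sum_congr rfl fun j _ => by ring
    rw [h]
    refine hp _ fun h0 => hx ?_
    ext i
    exact Fintype.linearIndependent_iff.1 b.linearIndependent x h0 i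

theorem frameComponents_injective (b : Module.Basis ι ℝ V) :
    Function.Injective (frameComponents (k := k) (b : ι → V)) := by
  intro η θ h
  have : η.toMultilinearMap = θ.toMultilinearMap :=
    Module.Basis.ext_multilinear (fun _ => b) fun v => congrFun h v
  ext v
  exact congrArg (fun f => f v) this

end LinearAlgebra

/-! ### Smoothness of the norm of a smooth form -/

section Smoothness

set_option linter.unusedSectionVars false

open Matrix

theorem contDiffOn_det {E ι : Type*} [NormedAddCommGroup E] [NormedSpace ℝ E] [Fintype ι]
    [DecidableEq ι] {G : E → Matrix ι ι ℝ} {s : Set E}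
    (hG : ∀ i j, ContDiffOn ℝ ∞ (fun y => G y i j) s) :
    ContDiffOn ℝ ∞ (fun y => (G y).det) s := by
  simp only [Matrix.det_apply']
  exact ContDiffOn.sum fun σ _ => contDiffOn_const.mul (contDiffOn_prod fun i _ => hG _ _)

theorem contDiffOn_tensorNormSq {E ι : Type*} [NormedAddCommGroup E] [NormedSpace ℝ E] [Fintype ι]
    [DecidableEq ι] {k : ℕ} {G : E → Matrix ι ι ℝ} {c : E → (Fin k → ι) → ℝ} {s : Set E}
    (hG : ∀ i j, ContDiffOn ℝ ∞ (fun y => G y i j) s) (hdet : ∀ y ∈ s, (G y).det ≠ 0)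
    (hc : ∀ I, ContDiffOn ℝ ∞ (fun y => c y I) s) :
    ContDiffOn ℝ ∞ (fun y => tensorNormSq (G y) (c y)) s := by
  have hinv : ∀ i j, ContDiffOn ℝ ∞ (fun y => (G y)⁻¹ i j) s := by
    intro i j
    -- Cramer's rule: entries of the inverse are quotients of determinants, the numerator having one
    -- row replaced by a constant one.
    simp only [Matrix.inv_def, Matrix.smul_apply, Ring.inverse_eq_inv', smul_eq_mul,
      Matrix.adjugate_apply]
    refine ((contDiffOn_det hG).inv hdet).mul (contDiffOn_det fun a b => ?_)
    by_cases h : a = j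
    · subst h
      simpa using contDiffOn_const
    · simpa [Matrix.updateRow_ne h] using hG a b
  refine contDiffOn_const.mul (ContDiffOn.sum fun I _ => ContDiffOn.sum fun J _ => ?_)
  exact ((contDiffOn_prod fun l _ => hinv _ _).mul (hc I)).mul (hc J)

variable {n : ℕ} [NeZero n] {M : Type*} [TopologicalSpace M]
  [ChartedSpace (EuclideanHalfSpace n) M]

/-- The standard basis of the model space as a basis of a tangent space. -/
def stdBasis (p : M) : Module.Basis (Fin n) ℝ (TangentSpace (𝓡∂ n) p) :=
  (EuclideanSpace.basisFun (Fin n) ℝ).toBasis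

theorem stdBasis_apply (p : M) : (stdBasis p : Fin n → TangentSpace (𝓡∂ n) p) = stdVec p := by
  ext1 i
  exact congrFun (EuclideanSpace.basisFun (Fin n) ℝ).coe_toBasis i |>.trans
    (EuclideanSpace.basisFun_apply _ _ i)

theorem normSq_eq_tensorNormSq {k : ℕ} (g : BilinField n M) (η : Form n M k) (p : M)
    (b : Module.Basis (Fin n) ℝ (TangentSpace (𝓡∂ n) p)) :
    normSq g η p = tensorNormSq (frameGram (g p) b) (frameComponents b (η p)) := by
  rw [tensorNormSq_basis_change _ _ (stdBasis p) b, stdBasis_apply]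
  rfl

/-- The pointwise norm of forms is induced by a Euclidean scalar product. -/
theorem exists_normSq_eq_norm_sq {k : ℕ} {g : BilinField n M} {p : M}
    (hs : ∀ v w, g p v w = g p w v) (hp : ∀ v, v ≠ 0 → 0 < g p v v) :
    ∃ L : (TangentSpace (𝓡∂ n) p [⋀^Fin k]→L[ℝ] ℝ) →ₗ[ℝ] EuclideanSpace ℝ (Fin k → Fin n),
      Function.Injective L ∧ ∀ η : Form n M k, normSq g η p = ‖L (η p)‖ ^ 2 := by
  obtain ⟨L, hL, h⟩ := exists_tensorNormSq_eq_norm_sq (k := k)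
    (frameGram_posDef hs hp (stdBasis p))
  let C : (TangentSpace (𝓡∂ n) p [⋀^Fin k]→L[ℝ] ℝ) →ₗ[ℝ] ((Fin k → Fin n) → ℝ) :=
    { toFun := frameComponents (stdBasis p)
      map_add' := fun _ _ => rfl
      map_smul' := fun _ _ => rfl }
  exact ⟨L ∘ₗ C, hL.comp (frameComponents_injective (stdBasis p)),
    fun η => (normSq_eq_tensorNormSq g η p (stdBasis p)).trans (h _)⟩

theorem normSq_smul {k : ℕ} {g : BilinField n M} {p : M}
    (hs : ∀ v w, g p v w = g p w v) (hp : ∀ v, v ≠ 0 → 0 < g p v v) (η : Form n M k)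
    {r : M → ℝ} (hr : r p ≠ 0) :
    normSq (fun q => r q • g q) η p = (r p ^ k)⁻¹ * normSq g η p := by
  rw [normSq_eq_tensorNormSq _ _ _ (stdBasis p), normSq_eq_tensorNormSq _ _ _ (stdBasis p),
    ← tensorNormSq_smul hr _
      ((Matrix.isUnit_iff_isUnit_det _).1 (frameGram_posDef hs hp (stdBasis p)).isUnit)]
  rfl

variable [IsManifold (𝓡∂ n) ∞ M]

/-- The coordinate frame of the chart around `x`. -/
def chartFrame (x : M) (i : Fin n) (p : M) : TangentSpace (𝓡∂ n) p :=
  (trivializationAt (Eu n) (TangentSpace (𝓡∂ n)) x).localFrame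
    (EuclideanSpace.basisFun (Fin n) ℝ).toBasis i p

theorem chartFrame_eq_basis {x p : M} (hp : p ∈ (chartAt (EuclideanHalfSpace n) x).source) :
    ∃ b : Module.Basis (Fin n) ℝ (TangentSpace (𝓡∂ n) p), ∀ i, b i = chartFrame x i p := by
  have hp' : p ∈ (trivializationAt (Eu n) (TangentSpace (𝓡∂ n)) x).baseSet := by simpa using hp
  exact ⟨(trivializationAt (Eu n) (TangentSpace (𝓡∂ n)) x).basisAt
    (EuclideanSpace.basisFun (Fin n) ℝ).toBasis hp', fun i =>
      ((trivializationAt (Eu n) (TangentSpace (𝓡∂ n)) x).localFrame_apply_of_mem_baseSet _ hp').symm⟩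

theorem symm_mem_source {x : M} {y : Eu n} (hy : y ∈ (extChartAt (𝓡∂ n) x).target) :
    (extChartAt (𝓡∂ n) x).symm y ∈ (chartAt (EuclideanHalfSpace n) x).source := by
  simpa using (extChartAt (𝓡∂ n) x).map_target hy

/-- Links the coordinate vectors in `volDensity` and `chartForm` to the local frame of the tangent
bundle, which is known to be smooth. -/
theorem chartInvDeriv_single {x : M} {y : Eu n} (hy : y ∈ (extChartAt (𝓡∂ n) x).target)
    (i : Fin n) : chartInvDeriv x y (EuclideanSpace.single i (1 : ℝ)) =
      chartFrame x i ((extChartAt (𝓡∂ n) x).symm y) := by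
  have : IsManifold (𝓡∂ n) 1 M := IsManifold.of_le (n := ∞) (by norm_cast)
  have hp := symm_mem_source hy
  have hp' : (extChartAt (𝓡∂ n) x).symm y ∈
    (trivializationAt (Eu n) (TangentSpace (𝓡∂ n)) x).baseSet := by simpa using hp
  have h1 := TangentBundle.symmL_trivializationAt (I := 𝓡∂ n) hp
  -- Giving `F` a constant codomain removes the dependence of the tangent space on `z`, so the base
  -- point can be rewritten by `right_inv`.
  let F : Eu n → (Eu n →L[ℝ] Eu n) := fun z =>
    mfderivWithin 𝓘(ℝ, Eu n) (𝓡∂ n) (extChartAt (𝓡∂ n) x).symm (range (𝓡∂ n)) z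
  have h2 : F (extChartAt (𝓡∂ n) x ((extChartAt (𝓡∂ n) x).symm y)) = F y :=
    congrArg F ((extChartAt (𝓡∂ n) x).right_inv hy)
  have h3 := congrArg (fun f : Eu n →L[ℝ] Eu n => f (EuclideanSpace.single i (1 : ℝ)))
    (h1.trans h2)
  refine Eq.trans h3.symm ?_
  rw [chartFrame, Trivialization.localFrame_apply_of_mem_baseSet _ _ hp']
  change _ = ((trivializationAt (Eu n) (TangentSpace (𝓡∂ n)) x).linearEquivAt ℝ _ hp').symm
    ((EuclideanSpace.basisFun (Fin n) ℝ).toBasis i)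
  rw [OrthonormalBasis.coe_toBasis, EuclideanSpace.basisFun_apply]
  exact Trivialization.symmL_apply _ hp' _

/-- The Gram matrix in the coordinate frame of the chart around `x`, as a function of the
coordinates. -/
def chartGram (g : BilinField n M) (x : M) (y : Eu n) : Matrix (Fin n) (Fin n) ℝ :=
  gram g ((extChartAt (𝓡∂ n) x).symm y)
    (fun i => chartInvDeriv x y (EuclideanSpace.single i (1 : ℝ)))

theorem chartGram_posDef {g : BilinField n M} {x : M} {y : Eu n}
    (hy : y ∈ (extChartAt (𝓡∂ n) x).target)
    (hs : ∀ p v w, g p v w = g p w v) (hp : ∀ p v, v ≠ 0 → 0 < g p v v) :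
    (chartGram g x y).PosDef := by
  obtain ⟨b, hb⟩ := chartFrame_eq_basis (symm_mem_source hy)
  convert frameGram_posDef (hs _) (hp _) b using 1
  simp only [chartGram, chartInvDeriv_single hy, ← hb]
  rfl

theorem normSq_symm_eq {k : ℕ} (g : BilinField n M) (η : Form n M k) {x : M} {y : Eu n}
    (hy : y ∈ (extChartAt (𝓡∂ n) x).target) :
    normSq g η ((extChartAt (𝓡∂ n) x).symm y) = tensorNormSq (chartGram g x y)
      (fun I => chartForm x η y fun l => EuclideanSpace.single (I l) (1 : ℝ)) := by
  obtain ⟨b, hb⟩ := chartFrame_eq_basis (symm_mem_source hy)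
  have hb' : (fun i => chartInvDeriv x y (EuclideanSpace.single i (1 : ℝ))) = b := by
    ext1 i
    rw [chartInvDeriv_single hy, hb]
  rw [normSq_eq_tensorNormSq _ _ _ b, ← hb']
  rfl

theorem contDiffOn_chartGram (g : Metric n M) (x : M) (i j : Fin n) :
    ContDiffOn ℝ ∞ (fun y => chartGram g.inner x y i j) (extChartAt (𝓡∂ n) x).target := by
  have hf : ∀ i, ContMDiffOn (𝓡∂ n) ((𝓡∂ n).prod 𝓘(ℝ, Eu n)) ∞
      (fun p : M => TotalSpace.mk' (Eu n) (E := TangentSpace (𝓡∂ n)) p (chartFrame x i p))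
      (chartAt (EuclideanHalfSpace n) x).source := by
    intro i
    have := (trivializationAt (Eu n) (TangentSpace (𝓡∂ n)) x).contMDiffOn_localFrame_baseSet
      (I := 𝓡∂ n) (n := ∞) (EuclideanSpace.basisFun (Fin n) ℝ).toBasis i
    simpa [chartFrame] using this
  have h1 : ContMDiffOn (𝓡∂ n) ((𝓡∂ n).prod 𝓘(ℝ)) ∞
      (fun p : M => TotalSpace.mk' ℝ (E := Bundle.Trivial M ℝ) p
        (g.inner p (chartFrame x i p) (chartFrame x j p)))
      (chartAt (EuclideanHalfSpace n) x).source :=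
    ContMDiffOn.clm_bundle_apply₂ (F₁ := Eu n) (F₂ := Eu n)
      g.contMDiff.contMDiffOn (hf i) (hf j)
  have h2 : ContMDiffOn (𝓡∂ n) 𝓘(ℝ) ∞
      (fun p : M => g.inner p (chartFrame x i p) (chartFrame x j p))
      (chartAt (EuclideanHalfSpace n) x).source := by
    intro p hp
    have := h1 p hp
    simp only [contMDiffWithinAt_totalSpace] at this
    exact this.2
  have h3 := h2.comp (contMDiffOn_extChartAt_symm (n := ∞) x) fun y hy => symm_mem_source hy
  rw [← contMDiffOn_iff_contDiffOn]
  refine h3.congr fun y hy => ?_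
  simp only [chartGram, gram, Matrix.of_apply, chartInvDeriv_single hy, Function.comp_apply]

theorem contMDiff_normSq {k : ℕ} (g : Metric n M) {η : Form n M k} (hη : IsSmoothForm η) :
    ContMDiff (𝓡∂ n) 𝓘(ℝ) ∞ (normSq g.inner η) := by
  have hon : ∀ x : M, ContMDiffOn (𝓡∂ n) 𝓘(ℝ) ∞ (normSq g.inner η)
      (chartAt (EuclideanHalfSpace n) x).source := by
    intro x
    have h1 : ContDiffOn ℝ ∞ (fun y => tensorNormSq (chartGram g.inner x y)
        (fun I : Fin k → Fin n => chartForm x η y fun l => EuclideanSpace.single (I l) (1 : ℝ)))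
        (extChartAt (𝓡∂ n) x).target := by
      refine contDiffOn_tensorNormSq (contDiffOn_chartGram g x)
        (fun y hy => (chartGram_posDef hy g.symm g.pos).det_pos.ne') fun I => ?_
      exact (ContinuousAlternatingMap.apply ℝ (Eu n) ℝ
        (fun l => EuclideanSpace.single (I l) (1 : ℝ))).contDiff.comp_contDiffOn (hη x)
    rw [← contMDiffOn_iff_contDiffOn] at h1
    refine (h1.comp (contMDiffOn_extChartAt (n := ∞) (x := x)) fun p hp =>
      (extChartAt (𝓡∂ n) x).map_source (by simpa using hp)).congr fun p hp => ?_
    have hp' : p ∈ (extChartAt (𝓡∂ n) x).source := by simpa using hp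
    rw [Function.comp_apply, ← normSq_symm_eq _ _ ((extChartAt (𝓡∂ n) x).map_source hp'),
      (extChartAt (𝓡∂ n) x).left_inv hp']
  exact fun x => (hon x).contMDiffAt
    ((chartAt (EuclideanHalfSpace n) x).open_source.mem_nhds (mem_chart_source _ x))

theorem IsSmoothForm.add_smul {k : ℕ} {η θ : Form n M k} (hη : IsSmoothForm η)
    (hθ : IsSmoothForm θ) (t : ℝ) : IsSmoothForm (η + t • θ) := fun x =>
  ContDiffOn.add (hη x) ((hθ x).const_smul t)

theorem continuousOn_volDensity (g : Metric n M) (x : M) :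
    ContinuousOn (volDensity g.inner x) (extChartAt (𝓡∂ n) x).target :=
  (contDiffOn_det (contDiffOn_chartGram g x)).continuousOn.sqrt

end Smoothness

/-! ### Differentiation under the Riemannian integral -/

section Integration

open MeasureTheory

variable {n : ℕ} [NeZero n] {M : Type*} [TopologicalSpace M] [T2Space M] [CompactSpace M]
  [ChartedSpace (EuclideanHalfSpace n) M] [IsManifold (𝓡∂ n) ∞ M]

/-- The contribution of the chart around `x` to the integral of `f`. -/
def chartIntegrand (g : BilinField n M) (f : M → ℝ) (x : M) (y : Eu n) : ℝ :=
  chartPartition n M x ((extChartAt (𝓡∂ n) x).symm y) *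
    f ((extChartAt (𝓡∂ n) x).symm y) * volDensity g x y

omit [T2Space M] [CompactSpace M] [IsManifold (𝓡∂ n) ∞ M] in
theorem measurableSet_extChartAt_target (x : M) :
    MeasurableSet (extChartAt (𝓡∂ n) x).target := by
  rw [extChartAt_target]
  exact ((chartAt (EuclideanHalfSpace n) x).open_target.preimage
    (𝓡∂ n).continuous_symm).measurableSet.inter (𝓡∂ n).isClosed_range.measurableSet

theorem integrableOn_chartIntegrand (g : Metric n M) {f : M → ℝ} (hf : Continuous f) (x : M) :
    IntegrableOn (chartIntegrand g.inner f x) (extChartAt (𝓡∂ n) x).target := by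
  -- The density may be unbounded on the chart target; integrability comes from the compact set `K`,
  -- outside which the partition function vanishes.
  set K : Set (Eu n) := extChartAt (𝓡∂ n) x '' tsupport (chartPartition n M x)
  have hsub : tsupport (chartPartition n M x) ⊆ (extChartAt (𝓡∂ n) x).source := by
    rw [extChartAt_source]
    exact chartPartition_isSubordinate n M x
  have hKt : K ⊆ (extChartAt (𝓡∂ n) x).target := by
    rintro _ ⟨p, hp, rfl⟩
    exact (extChartAt (𝓡∂ n) x).map_source (hsub hp)
  have hKc : IsCompact K := (isClosed_tsupport _).isCompact.image_of_continuousOn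
    ((continuousOn_extChartAt x).mono hsub)
  have hcont : ContinuousOn (chartIntegrand g.inner f x) (extChartAt (𝓡∂ n) x).target :=
    (((chartPartition n M x).contMDiff.continuous.comp_continuousOn
      (continuousOn_extChartAt_symm x)).mul (hf.comp_continuousOn
        (continuousOn_extChartAt_symm x))).mul (continuousOn_volDensity g x)
  refine IntegrableOn.of_forall_sdiff_eq_zero ((hcont.mono hKt).integrableOn_compact hKc)
    (measurableSet_extChartAt_target x) fun y hy => ?_
  have h0 : chartPartition n M x ((extChartAt (𝓡∂ n) x).symm y) = 0 := by
    by_contra h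
    exact hy.2 ⟨_, subset_tsupport _ h, (extChartAt (𝓡∂ n) x).right_inv hy.1⟩
  rw [chartIntegrand, h0, zero_mul, zero_mul]

/-- By compactness, finitely many partition functions are nonzero. The same `S` serves all `f`, so
the integral of a family in `t` can be differentiated termwise. -/
theorem exists_volIntegral_eq_sum (g : BilinField n M) :
    ∃ S : Finset M, ∀ f : M → ℝ, volIntegral g f =
      ∑ x ∈ S, ∫ y in (extChartAt (𝓡∂ n) x).target, chartIntegrand g f x y := by
  have hfin : {x : M | (Function.support (chartPartition n M x)).Nonempty}.Finite :=
    (chartPartition n M).locallyFinite.finite_nonempty_of_compact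
  refine ⟨hfin.toFinset, fun f => finsum_eq_sum_of_support_subset _ fun x hx => ?_⟩
  simp only [Finite.coe_toFinset, Set.mem_ofPred_eq]
  by_contra h
  have h0 : ∀ p, chartPartition n M x p = 0 := fun p => by
    by_contra hp
    exact h ⟨p, hp⟩
  exact hx (by simp [h0])

/-- Domination is by a Lipschitz bound, with differentiability at `t = 0` alone: |β| |β + tγ| may
fail to be differentiable at other `t`, where β + tγ vanishes. -/
theorem hasDerivAt_volIntegral (g : Metric n M) {f : ℝ → M → ℝ} {f' C : M → ℝ}
    (hf : ∀ t, Continuous (f t)) (hf' : Continuous f') (hC : Continuous C)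
    (hlip : ∀ p, ∀ s ∈ Metric.ball (0 : ℝ) 1, ∀ t ∈ Metric.ball (0 : ℝ) 1,
      |f s p - f t p| ≤ C p * |s - t|)
    (hderiv : ∀ p, HasDerivAt (fun t => f t p) (f' p) 0) :
    HasDerivAt (fun t => volIntegral g.inner (f t)) (volIntegral g.inner f') 0 := by
  obtain ⟨S, hS⟩ := exists_volIntegral_eq_sum g.inner
  simp only [hS]
  refine HasDerivAt.fun_sum fun x _ => ?_
  refine (hasDerivAt_integral_of_dominated_loc_of_lip
    (F := fun t y => chartIntegrand g.inner (f t) x y) (F' := chartIntegrand g.inner f' x)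
    (bound := chartIntegrand g.inner C x) (Metric.ball_mem_nhds 0 one_pos)
    (.of_forall fun t => (integrableOn_chartIntegrand g (hf t) x).aestronglyMeasurable)
    (integrableOn_chartIntegrand g (hf 0) x)
    (integrableOn_chartIntegrand g hf' x).aestronglyMeasurable (.of_forall fun y => ?_)
    (integrableOn_chartIntegrand g hC x) (.of_forall fun y => ?_)).2
  · refine LipschitzOnWith.of_dist_le_mul fun s hs t ht => ?_
    have h1 := (chartPartition n M).nonneg x ((extChartAt (𝓡∂ n) x).symm y)
    have h2 : 0 ≤ volDensity g.inner x y := Real.sqrt_nonneg _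
    rw [Real.dist_eq, Real.dist_eq, Real.coe_nnabs]
    refine le_trans ?_ (mul_le_mul_of_nonneg_right (le_abs_self _) (abs_nonneg _))
    simp only [chartIntegrand]
    rw [← sub_mul, ← mul_sub, abs_mul, abs_mul, abs_of_nonneg h1, abs_of_nonneg h2]
    calc _ ≤ chartPartition n M x ((extChartAt (𝓡∂ n) x).symm y) *
          (C ((extChartAt (𝓡∂ n) x).symm y) * |s - t|) * volDensity g.inner x y := by
            gcongr
            exact hlip _ s hs t ht
      _ = _ := by ring
  · exact ((hderiv _).const_mul _).mul_const _

theorem volIntegral_const_mul (g : BilinField n M) (r : ℝ) (f : M → ℝ) :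
    volIntegral g (fun p => r * f p) = r * volIntegral g f := by
  obtain ⟨S, hS⟩ := exists_volIntegral_eq_sum g
  rw [hS, hS, Finset.mul_sum]
  refine Finset.sum_congr rfl fun x _ => ?_
  rw [← integral_const_mul]
  congr 1
  ext y
  simp only [chartIntegrand]
  ring

end Integration

/-! ### Derivatives of norms along lines -/

section NormDerivative

variable {E : Type*} [NormedAddCommGroup E] [InnerProductSpace ℝ E]

theorem abs_norm_add_smul_sub_le (a b : E) (s t : ℝ) :
    |‖a + s • b‖ - ‖a + t • b‖| ≤ ‖b‖ * |s - t| := by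
  refine (abs_norm_sub_norm_le _ _).trans_eq ?_
  rw [add_sub_add_left_eq_sub, ← sub_smul, norm_smul, Real.norm_eq_abs, mul_comm]

theorem abs_norm_sq_add_smul_sub_le (a b : E) {s t : ℝ} (hs : |s| ≤ 1) (ht : |t| ≤ 1) :
    |‖a + s • b‖ ^ 2 - ‖a + t • b‖ ^ 2| ≤ 2 * ((‖a‖ + ‖b‖) * ‖b‖) * |s - t| := by
  have h : ∀ r : ℝ, |r| ≤ 1 → ‖a + r • b‖ ≤ ‖a‖ + ‖b‖ := fun r hr => by
    refine (norm_add_le _ _).trans ?_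
    rw [norm_smul, Real.norm_eq_abs]
    gcongr
    exact mul_le_of_le_one_left (norm_nonneg b) hr
  rw [sq_sub_sq, abs_mul]
  calc |‖a + s • b‖ + ‖a + t • b‖| * |‖a + s • b‖ - ‖a + t • b‖|
      ≤ ((‖a‖ + ‖b‖) + (‖a‖ + ‖b‖)) * (‖b‖ * |s - t|) := by
        rw [abs_of_nonneg (by positivity)]
        exact mul_le_mul (add_le_add (h s hs) (h t ht)) (abs_norm_add_smul_sub_le a b s t)
          (abs_nonneg _) (by positivity)
    _ = _ := by ring

theorem hasDerivAt_norm_sq_add_smul (a b : E) :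
    HasDerivAt (fun t : ℝ => ‖a + t • b‖ ^ 2) (2 * inner ℝ a b) 0 := by
  have h : HasDerivAt (fun t : ℝ => a + t • b) b 0 := by
    simpa using ((hasDerivAt_id (0 : ℝ)).smul_const b).const_add a
  simpa using h.norm_sq

/-- The norm is not differentiable at 0, but for `a = 0` the prefactor makes the function
identically zero, in agreement with `inner ℝ 0 b = 0`. -/
theorem hasDerivAt_norm_mul_norm_add_smul (a b : E) :
    HasDerivAt (fun t : ℝ => ‖a‖ * ‖a + t • b‖) (inner ℝ a b) 0 := by
  rcases eq_or_ne a 0 with rfl | ha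
  · simpa using hasDerivAt_const (0 : ℝ) (0 : ℝ)
  · have ha' : ‖a‖ ≠ 0 := norm_ne_zero_iff.2 ha
    have := ((hasDerivAt_norm_sq_add_smul a b).sqrt (by simpa using ha)).const_mul ‖a‖
    simp only [Real.sqrt_sq (norm_nonneg _), zero_smul, add_zero] at this
    refine this.congr_deriv ?_
    field_simp

end NormDerivative

/-! ### The conformally changed metric -/

section Conformal

variable {n : ℕ} [NeZero n] {M : Type*} [TopologicalSpace M]
  [ChartedSpace (EuclideanHalfSpace n) M]

theorem volDensity_smul (g : BilinField n M) {r : M → ℝ} (x : M) (y : Eu n)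
    (hr : 0 ≤ r ((extChartAt (𝓡∂ n) x).symm y)) :
    volDensity (fun p => r p • g p) x y =
      √(r ((extChartAt (𝓡∂ n) x).symm y) ^ n) * volDensity g x y := by
  have h : ∀ (p : M) (b : Fin n → TangentSpace (𝓡∂ n) p),
      gram (fun p => r p • g p) p b = r p • gram g p b := fun p b => rfl
  rw [volDensity, h, Matrix.det_smul, Fintype.card_fin, Real.sqrt_mul (pow_nonneg hr n)]
  rfl

variable [IsManifold (𝓡∂ n) ∞ M] {k : ℕ}

theorem normSq_nonneg (g : Metric n M) (η : Form n M k) (p : M) : 0 ≤ normSq g.inner η p := by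
  obtain ⟨L, -, h⟩ := exists_normSq_eq_norm_sq (k := k) (g.symm p) (g.pos p)
  rw [h]
  positivity

theorem normSq_eq_zero_iff (g : Metric n M) (η : Form n M k) (p : M) :
    normSq g.inner η p = 0 ↔ η p = 0 := by
  obtain ⟨L, hL, h⟩ := exists_normSq_eq_norm_sq (k := k) (g.symm p) (g.pos p)
  rw [h, sq_eq_zero_iff, norm_eq_zero, map_eq_zero_iff L hL]

theorem normSq_pos_of_mem (g : Metric n M) {β : Form n M k} {p : M} (hp : p ∈ nonvanishing β) :
    0 < normSq g.inner β p :=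
  (normSq_nonneg g β p).lt_of_ne' fun h => hp ((normSq_eq_zero_iff g β p).1 h)

theorem normSq_conformalChange (g : Metric n M) {β : Form n M k} {p : M}
    (hp : p ∈ nonvanishing β) (η : Form n M k) :
    normSq (conformalChange g.inner β) η p =
      (normSq g.inner β p ^ k)⁻¹ * normSq g.inner η p :=
  normSq_smul (g.symm p) (g.pos p) η (normSq_pos_of_mem g hp).ne'

set_option synthInstance.maxHeartbeats 200000 in
theorem contMDiff_smul_inner (g : Metric n M) {r : M → ℝ} (hr : ContMDiff (𝓡∂ n) 𝓘(ℝ) ∞ r) :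
    ContMDiff (𝓡∂ n) ((𝓡∂ n).prod 𝓘(ℝ, Eu n →L[ℝ] Eu n →L[ℝ] ℝ)) ∞
      (fun p : M => TotalSpace.mk' (Eu n →L[ℝ] Eu n →L[ℝ] ℝ)
        (E := fun p : M => TangentSpace (𝓡∂ n) p →L[ℝ] TangentSpace (𝓡∂ n) p →L[ℝ] ℝ)
        p (r p • g.inner p)) :=
  hr.smul_section g.contMDiff

theorem isRiemannianMetricOn_conformalChange (g : Metric n M) {β : Form n M k}
    (hβ : IsSmoothForm β) :
    IsRiemannianMetricOn (conformalChange g.inner β) (nonvanishing β) where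
  symm p _ v w := congrArg (normSq g.inner β p * ·) (g.symm p v w)
  pos p hp v hv := mul_pos (normSq_pos_of_mem g hp) (g.pos p v hv)
  smooth := (contMDiff_smul_inner g (contMDiff_normSq g hβ)).contMDiffOn

theorem metric_ext {g h : Metric n M} (H : g.inner = h.inner) : g = h := by
  cases g
  cases h
  cases H
  rfl

/-- The product of a Riemannian metric with a positive smooth function. -/
def scaledMetric (h : Metric n M) (r : M → ℝ) (hr : ∀ p, 0 < r p)
    (hsm : ContMDiff (𝓡∂ n) 𝓘(ℝ) ∞ r) : Metric n M where
  inner p := r p • h.inner p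
  symm p v w := congrArg (r p * ·) (h.symm p v w)
  pos p v hv := mul_pos (hr p) (h.pos p v hv)
  isVonNBounded p := by
    -- The unit ball of `r p • h.inner p` is contained in the image of that of `h.inner p` under
    -- multiplication by `(√(r p))⁻¹`.
    refine ((h.isVonNBounded p).image ((√(r p))⁻¹ •
      ContinuousLinearMap.id ℝ (TangentSpace (𝓡∂ n) p))).subset fun v hv => ?_
    have hs : √(r p) ≠ 0 := (Real.sqrt_pos.2 (hr p)).ne'
    refine ⟨√(r p) • v, ?_, ?_⟩
    · have hv' : r p * h.inner p v v < 1 := hv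
      simpa [← mul_assoc, Real.mul_self_sqrt (hr p).le] using hv'
    · simp [smul_smul, hs]
  contMDiff := contMDiff_smul_inner h hsm

end Conformal

/-! ### First variations of the two functionals, and inversion of the conformal change. -/

section FluxForms

set_option linter.unusedSectionVars false

variable {m : ℕ} {M : Type*} [TopologicalSpace M] [ChartedSpace (EuclideanHalfSpace (m + 2)) M]
  [IsManifold (𝓡∂ (m + 2)) ∞ M]

section Functionals

variable [T2Space M] [CompactSpace M]

/-- For the metric `|β|² g`, the `L¹` norm of a flux form is the integral of `|β| |η|`. -/
theorem l1NormOn_conformalChange (g : Metric (m + 2) M) (β η : Form (m + 2) M (m + 1)) :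
    l1NormOn (conformalChange g.inner β) (nonvanishing β) η =
      volIntegral g.inner (fun p => √(normSq g.inner β p) * √(normSq g.inner η p)) := by
  unfold l1NormOn volIntegral
  refine finsum_congr fun x => ?_
  congr 1
  ext y
  rw [mul_assoc, mul_assoc]
  congr 1
  set p := (extChartAt (𝓡∂ (m + 2)) x).symm y with hp_def
  beta_reduce
  rw [show conformalChange g.inner β = fun p => normSq g.inner β p • g.inner p from rfl,
    volDensity_smul _ _ _ (normSq_nonneg g β _), ← hp_def]
  by_cases hp : p ∈ nonvanishing β
  · have hpos := normSq_pos_of_mem g hp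
    rw [indicator_of_mem hp, ← show conformalChange g.inner β =
      fun p => normSq g.inner β p • g.inner p from rfl, normSq_conformalChange g hp,
      Real.sqrt_mul (by positivity), ← mul_assoc]
    congr 1
    -- The powers for degree `m + 1` in dimension `m + 2` leave one factor: λ^(-(m+1)) · λ^(m+2) = λ
    -- under the root.
    rw [mul_right_comm, ← Real.sqrt_mul (by positivity)]
    congr 2
    rw [pow_succ _ (m + 1)]
    field_simp
  · have h0 : normSq g.inner β p = 0 := (normSq_eq_zero_iff g β p).2 (not_not.1 hp)
    rw [indicator_of_notMem hp, h0, Real.sqrt_zero, zero_mul, zero_mul, zero_mul]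

/-- The pointwise scalar product of two forms, by polarization. -/
def normPolar (g : BilinField (m + 2) M) (β γ : Form (m + 2) M (m + 1)) (p : M) : ℝ :=
  (normSq g (β + (1 : ℝ) • γ) p - normSq g β p - normSq g γ p) / 2

/-- Reduces pointwise questions at `p` to a line `a + t • b` in a Euclidean space, with the same
`a`, `b` for all `t`. -/
theorem exists_norm_representation (g : Metric (m + 2) M) (β γ : Form (m + 2) M (m + 1)) (p : M) :
    ∃ a b : EuclideanSpace ℝ (Fin (m + 1) → Fin (m + 2)), normSq g.inner β p = ‖a‖ ^ 2 ∧
      normSq g.inner γ p = ‖b‖ ^ 2 ∧ normPolar g.inner β γ p = inner ℝ a b ∧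
      ∀ t : ℝ, normSq g.inner (β + t • γ) p = ‖a + t • b‖ ^ 2 := by
  obtain ⟨L, -, h⟩ := exists_normSq_eq_norm_sq (k := m + 1) (g.symm p) (g.pos p)
  have ht : ∀ t : ℝ, normSq g.inner (β + t • γ) p = ‖L (β p) + t • L (γ p)‖ ^ 2 := fun t => by
    rw [h, ← map_smul, ← map_add]
    rfl
  refine ⟨L (β p), L (γ p), h β, h γ, ?_, ht⟩
  rw [normPolar, ht, h β, h γ, one_smul, norm_add_sq_real]
  ring

theorem continuous_normPolar (g : Metric (m + 2) M) {β γ : Form (m + 2) M (m + 1)}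
    (hβ : IsSmoothForm β) (hγ : IsSmoothForm γ) : Continuous (normPolar g.inner β γ) :=
  (((contMDiff_normSq g (hβ.add_smul hγ 1)).continuous.sub
    (contMDiff_normSq g hβ).continuous).sub (contMDiff_normSq g hγ).continuous).div_const 2

theorem hasDerivAt_l2NormSq (g : Metric (m + 2) M) {β γ : Form (m + 2) M (m + 1)}
    (hβ : IsSmoothForm β) (hγ : IsSmoothForm γ) :
    HasDerivAt (fun t : ℝ => l2NormSq g.inner (β + t • γ))
      (2 * volIntegral g.inner (normPolar g.inner β γ)) 0 := by
  rw [← volIntegral_const_mul]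
  have hcβ := (contMDiff_normSq g hβ).continuous
  have hcγ := (contMDiff_normSq g hγ).continuous
  refine hasDerivAt_volIntegral g (f := fun t p => normSq g.inner (β + t • γ) p)
    (C := fun p => 2 * ((√(normSq g.inner β p) + √(normSq g.inner γ p)) * √(normSq g.inner γ p)))
    (fun t => (contMDiff_normSq g (hβ.add_smul hγ t)).continuous)
    (continuous_const.mul (continuous_normPolar g hβ hγ)) (by fun_prop)
    (fun p s hs t ht => ?_) fun p => ?_
  · obtain ⟨a, b, ha, hb, -, hab⟩ := exists_norm_representation g β γ p
    simp only [hab, ha, hb, Real.sqrt_sq (norm_nonneg _)]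
    rw [mem_ball_zero_iff, Real.norm_eq_abs] at hs ht
    exact abs_norm_sq_add_smul_sub_le a b hs.le ht.le
  · obtain ⟨a, b, -, -, hi, hab⟩ := exists_norm_representation g β γ p
    simp only [hab, hi]
    exact hasDerivAt_norm_sq_add_smul a b

theorem hasDerivAt_l1NormOn (g : Metric (m + 2) M) {β γ : Form (m + 2) M (m + 1)}
    (hβ : IsSmoothForm β) (hγ : IsSmoothForm γ) :
    HasDerivAt (fun t : ℝ => l1NormOn (conformalChange g.inner β) (nonvanishing β) (β + t • γ))
      (volIntegral g.inner (normPolar g.inner β γ)) 0 := by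
  simp only [l1NormOn_conformalChange]
  have hcβ := (contMDiff_normSq g hβ).continuous
  have hcγ := (contMDiff_normSq g hγ).continuous
  refine hasDerivAt_volIntegral g
    (f := fun t p => √(normSq g.inner β p) * √(normSq g.inner (β + t • γ) p))
    (C := fun p => √(normSq g.inner β p) * √(normSq g.inner γ p))
    (fun t => hcβ.sqrt.mul (contMDiff_normSq g (hβ.add_smul hγ t)).continuous.sqrt)
    (continuous_normPolar g hβ hγ) (by fun_prop)
    (fun p s hs t ht => ?_) fun p => ?_
  · obtain ⟨a, b, ha, hb, -, hab⟩ := exists_norm_representation g β γ p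
    simp only [hab, ha, hb, Real.sqrt_sq (norm_nonneg _)]
    rw [← mul_sub, abs_mul, abs_norm, mul_assoc]
    gcongr
    exact abs_norm_add_smul_sub_le a b s t
  · obtain ⟨a, b, ha, -, hi, hab⟩ := exists_norm_representation g β γ p
    simp only [hab, ha, hi, Real.sqrt_sq (norm_nonneg _)]
    exact hasDerivAt_norm_mul_norm_add_smul a b

/-- Both derivatives exist along every smooth variation and differ by the factor 2, so by uniqueness
of derivatives one vanishes exactly when the other does. Of admissibility, only smoothness of the
variation enters. -/
theorem isStationary_l2NormSq_iff (g : Metric (m + 2) M) {β : Form (m + 2) M (m + 1)}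
    (hβ : IsSmoothForm β) (c : Constraint) :
    IsStationary c (l2NormSq g.inner) β ↔
      IsStationary c (l1NormOn (conformalChange g.inner β) (nonvanishing β)) β := by
  refine forall₂_congr fun γ hγ => ⟨fun h => ?_, fun h => ?_⟩
  · have h0 := (hasDerivAt_l2NormSq g hβ hγ.1).unique h
    simpa [(mul_eq_zero.1 h0).resolve_left two_ne_zero] using hasDerivAt_l1NormOn g hβ hγ.1
  · have h0 := (hasDerivAt_l1NormOn g hβ hγ.1).unique h
    simpa [h0] using hasDerivAt_l2NormSq g hβ hγ.1

theorem l2NormSq_eq_l1NormOn (g : Metric (m + 2) M) (β : Form (m + 2) M (m + 1)) :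
    l2NormSq g.inner β = l1NormOn (conformalChange g.inner β) (nonvanishing β) β := by
  rw [l1NormOn_conformalChange, l2NormSq]
  congr 1
  ext p
  rw [Real.mul_self_sqrt (normSq_nonneg g β p)]

end Functionals

/-- For a nowhere vanishing flux form `β`, every metric is `|β|_g² g` for exactly one metric `g`. -/
theorem existsUnique_conformalChange_eq (hm : m ≠ 0) {β : Form (m + 2) M (m + 1)}
    (hβ : IsSmoothForm β) (hnv : nonvanishing β = univ) (h : Metric (m + 2) M) :
    ∃! g : Metric (m + 2) M, conformalChange g.inner β = h.inner := by
  have hmem : ∀ p, p ∈ nonvanishing β := fun p => hnv ▸ mem_univ p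
  have hpos := fun p => normSq_pos_of_mem h (hmem p)
  -- For `g = r • h`, |β|²_g = r^(-(m+1)) |β|²_h, so |β|²_g g = h amounts to r^m = |β|²_h.
  set r : M → ℝ := fun p => normSq h.inner β p ^ ((m : ℝ)⁻¹) with hr_def
  have hr : ∀ p, 0 < r p := fun p => Real.rpow_pos_of_pos (hpos p) _
  have hrm : ∀ p, r p ^ m = normSq h.inner β p := fun p =>
    Real.rpow_inv_natCast_pow (hpos p).le hm
  have hsm : ContMDiff (𝓡∂ (m + 2)) 𝓘(ℝ) ∞ r := fun p =>
    (Real.contDiffAt_rpow_const_of_ne (hpos p).ne').contMDiffAt.comp p (contMDiff_normSq h hβ p)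
  refine ⟨scaledMetric h r hr hsm, ?_, fun g hg => metric_ext ?_⟩
  · ext1 p
    change normSq (fun q => r q • h.inner q) β p • r p • h.inner p = h.inner p
    rw [normSq_smul (h.symm p) (h.pos p) β (hr p).ne', smul_smul, ← hrm p, pow_succ]
    have := (hr p).ne'
    rw [show (r p ^ m * r p)⁻¹ * r p ^ m * r p = 1 by field_simp, one_smul]
  · ext1 p
    have hl := normSq_pos_of_mem g (hmem p)
    -- Any solution `g`, with λ = |β|²_g, satisfies |β|²_h = λ^(-(m+1)) λ = λ^(-m). Taking the m-th
    -- root forces λ⁻¹ = r, hence g = r h.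
    have h1 : normSq h.inner β p = (normSq g.inner β p)⁻¹ ^ m := by
      rw [← hg, normSq_conformalChange g (hmem p), pow_succ, inv_pow]
      field_simp
    have h2 : r p = (normSq g.inner β p)⁻¹ := by
      rw [hr_def]
      simp only [h1]
      exact Real.pow_rpow_inv_natCast (inv_pos.2 hl).le hm
    change g.inner p = r p • h.inner p
    rw [h2, ← hg]
    change _ = (normSq g.inner β p)⁻¹ • normSq g.inner β p • g.inner p
    rw [smul_smul, inv_mul_cancel₀ hl.ne', one_smul]

end FluxForms

end FluxForm

end
theorem mainTheorem2 (m : ℕ) (hn : 3 ≤ m + 2) {M : Type*} [TopologicalSpace M] [T2Space M]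
    [CompactSpace M] [ChartedSpace (EuclideanHalfSpace (m + 2)) M]
    [IsManifold (𝓡∂ (m + 2)) ∞ M]
    (β : FluxForm.Form (m + 2) M (m + 1)) (hβ : FluxForm.IsSmoothForm β)
    (hclosed : FluxForm.extD β = 0) :
    (∀ g : FluxForm.Metric (m + 2) M,
      FluxForm.IsRiemannianMetricOn (FluxForm.conformalChange g.inner β)
        (FluxForm.nonvanishing β) ∧
      FluxForm.l2NormSq g.inner β =
        FluxForm.l1NormOn (FluxForm.conformalChange g.inner β) (FluxForm.nonvanishing β) β ∧
      ∀ c : FluxForm.Constraint,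
        FluxForm.IsStationary c (FluxForm.l2NormSq g.inner) β ↔
        FluxForm.IsStationary c
          (FluxForm.l1NormOn (FluxForm.conformalChange g.inner β) (FluxForm.nonvanishing β)) β) ∧
    (FluxForm.nonvanishing β = Set.univ →
      ∀ h : FluxForm.Metric (m + 2) M, ∃! g : FluxForm.Metric (m + 2) M,
        FluxForm.conformalChange g.inner β = h.inner) := by
  have hm : m ≠ 0 := by omega
  exact ⟨fun g => ⟨FluxForm.isRiemannianMetricOn_conformalChange g hβ,
    FluxForm.l2NormSq_eq_l1NormOn g β, FluxForm.isStationary_l2NormSq_iff g hβ⟩,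
    FluxForm.existsUnique_conformalChange_eq hm hβ⟩
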